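/- Let $(X,\mathcal F,\mu)$ be a $\sigma$-finite measure space and $\mathcal A\subseteq\mathcal F$ a $\sigma$-subalgebra such that $\mu|_{\mathcal A}$ is $\sigma$-finite. Write $E$ for the conditional expectation with respect to $\mathcal A$, defined for non-negative measurable functions and for all measurable $h:X\to\mathbb C$ with $E(|h|)<\infty$ a.e. Let $w,u:X\to\mathbb C$ be measurable with $E(|w|)<\infty$ and $E(|u|)<\infty$ a.e. and $E(|u|^2)\in L^\infty$, and suppose that $T=M_wEM_u$, $Th=w\,E(uh)$, is a bounded operator on the complex Hilbert space $L^2(\mathcal F)$. Let $r(T)$ be the spectral radius of $T$ and, for $m\ge 1$, put $d_m=\frac{1}{1/m+r(T)}$ and $R_m=\big(\sum_{n\ge0}d_m^{2n}T^{*n}T^n\big)^{1/2}$. The spectral radius algebra $\mathcal B_T$ consists of all bounded operators $S$ on $L^2(\mathcal F)$ with $\sup_{m\ge 1}\|R_mSR_m^{-1}\|<\infty$. Put $$v_m=\frac{d_m^2E(|w|^2)}{1-d_m^2|E(uw)|^2},\qquad \alpha_m=\frac{v_m}{1+v_mE(|u|^2)},$$ where $v_m$ is given the value $0$ at points where $E(|w|^2)=\infty$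 (almost everywhere on this set $u=0$). Let $f,g\in L^2(\mathcal F)$ and let $f\otimes g$ be the operator $h\mapsto\langle h,g\rangle f$, with $\langle\cdot,\cdot\rangle$ linear in the first variable. Then $v_m^{1/2}E(uf)$ and $\alpha_m^{1/2}E(ug)$ are in $L^2(\mathcal F)$ for every $m\ge 1$, and $f\otimes g\in\mathcal B_T$ if and only if $$\sup_{m\ge1}\Big(-\|\alpha_m^{1/2}E(ug)\|^2\|f\|^2+\|v_m^{1/2}E(uf)\|^2\big(\|g\|^2-\|\alpha_m^{1/2}E(ug)\|^2\big)\Big)<\infty .$$ -/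

import Mathlib

open MeasureTheory

noncomputable section

namespace SpectralRadiusAlgebra

section Hilbert

variable {H : Type*} [NormedAddCommGroup H] [InnerProductSpace ℂ H] [CompleteSpace H]

/-- The numbers `d_m = 1 / (1/m + r(T))`, where `r(T)` is the spectral radius of `T`. -/
def d (T : H →L[ℂ] H) (m : ℕ+) : ℝ :=
  1 / (1 / (m : ℝ) + (spectralRadius ℂ T).toReal)

/-- `R_m = (∑ₙ d_m²ⁿ (T*)ⁿ Tⁿ)^(1/2)`, the series being taken in the operator norm. -/
def R (T : H →L[ℂ] H) (m : ℕ+) : H →L[ℂ] H :=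
  CFC.sqrt (∑' n : ℕ, (d T m) ^ (2 * n) • (ContinuousLinearMap.adjoint T ^ n * T ^ n))

/-- The spectral radius algebra `B_T` of all bounded `S` with `sup_m ‖R_m S R_m⁻¹‖ < ∞`. -/
def algebraB (T : H →L[ℂ] H) : Set (H →L[ℂ] H) :=
  {S | BddAbove (Set.range fun m : ℕ+ => ‖R T m * S * Ring.inverse (R T m)‖)}

end Hilbert

section CondExp

variable {X : Type*} (𝒜 : MeasurableSpace X) {ℱ : MeasurableSpace X} (μ : Measure X)

/-- `f ∈ D(E)`: `f` is measurable and `E(|f|)` is finite almost everywhere. -/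
def Conditionable (f : X → ℂ) : Prop :=
  AEStronglyMeasurable f μ ∧ ∀ᵐ x ∂μ, condLExp 𝒜 μ (fun y => ‖f y‖ₑ) x < ⊤

/-- `E(f)` for a conditionable, not necessarily integrable, real function: `E(f⁺) - E(f⁻)`. -/
def condReal (f : X → ℝ) (x : X) : ℝ :=
  (condLExp 𝒜 μ (fun y => ENNReal.ofReal (f y)) x).toReal
    - (condLExp 𝒜 μ (fun y => ENNReal.ofReal (-f y)) x).toReal

/-- `E(f)` for a conditionable complex function. -/
def condE (f : X → ℂ) (x : X) : ℂ :=
  (condReal 𝒜 μ (fun y => (f y).re) x : ℂ) + (condReal 𝒜 μ (fun y => (f y).im) x : ℂ) * Complex.I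

/-- `E(|f|²)`, with values in `[0, ∞]`. -/
def condSq (f : X → ℂ) : X → ENNReal :=
  condLExp 𝒜 μ (fun y => ‖f y‖ₑ ^ 2)

/-- `v = d² E(|w|²) / (1 - d² |E(uw)|²)`. -/
def v (w u : X → ℂ) (d : ℝ) (x : X) : ℝ :=
  d ^ 2 * (condSq 𝒜 μ w x).toReal / (1 - d ^ 2 * ‖condE 𝒜 μ (fun y => u y * w y) x‖ ^ 2)

/-- `α = v / (1 + v E(|u|²))`. -/
def α (w u : X → ℂ) (d : ℝ) (x : X) : ℝ :=
  v 𝒜 μ w u d x / (1 + v 𝒜 μ w u d x * (condSq 𝒜 μ u x).toReal)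

/-- The function `a^(1/2) E(uf)`, for a weight `a`. -/
def weighted (a : X → ℝ) (u f : X → ℂ) (x : X) : ℂ :=
  (Real.sqrt (a x) : ℂ) * condE 𝒜 μ (fun y => u y * f y) x

/-- The norm of a square integrable function in `L²`. -/
def norm2 (f : X → ℂ) : ℝ := (eLpNorm f 2 μ).toReal

end CondExp

end SpectralRadiusAlgebra

end

namespace SpectralRadiusAlgebra

/-! ### Hilbert space: the series defining `R_m²` and conjugated rank-one operators. -/

section Hilbert

open Filter Topology ContinuousLinearMap
open scoped InnerProductSpace

variable {H : Type*} [NormedAddCommGroup H] [InnerProductSpace ℂ H] [CompleteSpace H]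

/-! Conjugation turns a rank-one operator into a rank-one operator, so `‖R_m (f ⊗ g) R_m⁻¹‖ = ‖R_m
f‖ ‖R_m⁻¹ g‖`, and both factors can be computed exactly.

Since `E(uw)` is `𝒜`-measurable, it pulls out of `E`, and `T^(n+1) h = E(uw)^n T h`. The series for
`R_m²` is therefore geometric: `R_m² = 1 + W*W` with `W = φT` and `φ² = d_m² / (1 - d_m² |E(uw)|²)`
(`pow_succ_apply_ae`, `exists_sqrt_weight_mul`). Conditioning `|w|²` gives `‖W h‖ = ‖v_m^(1/2)
E(uh)‖` (`lintegral_weighted_v`), hence `‖R_m f‖² = ‖f‖² + ‖v_m^(1/2) E(uf)‖²`.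

For the other factor, `W*W h = v_m E(uh) ū`, so `R_m² k = g` is solved by `k = g - α_m E(ug) ū`, and
`‖R_m⁻¹ g‖² = ⟨k, g⟩ = ‖g‖² - ‖α_m^(1/2) E(ug)‖²`. The product of the two squares is `‖f‖² ‖g‖²`
plus the expression in the theorem, so one family is bounded exactly when the other is.

Two points need care: `d_m |E(uw)| < 1` almost everywhere (`d_mul_norm_condE_lt_one`), and the set
where `E(|w|²) = ∞`, on which boundedness of `T` forces `u = 0`. -/

omit [CompleteSpace H] in
theorem d_pos (T : H →L[ℂ] H) (m : ℕ+) : 0 < d T m := by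
  have : (0 : ℝ) < m := by exact_mod_cast m.pos
  unfold d
  positivity

/-- By Gelfand's formula `‖T^n‖ ≤ ρ^n` eventually for each `ρ > r(T)`; since `1/d_m` exceeds `r(T)`,
a geometric series dominates. -/
theorem summable_d_pow_mul_norm_pow_sq (T : H →L[ℂ] H) (m : ℕ+) :
    Summable fun n : ℕ => d T m ^ (2 * n) * ‖T ^ n‖ ^ 2 := by
  have hm : (0 : ℝ) < 1 / m := by
    have : (0 : ℝ) < m := by exact_mod_cast m.pos
    positivity
  have hd := d_pos T m
  set r := (spectralRadius ℂ T).toReal with hr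
  have hr0 : 0 ≤ r := ENNReal.toReal_nonneg
  have hfin : spectralRadius ℂ T ≠ ⊤ := by
    have h := spectrum.spectralRadius_le_pow_nnnorm_pow_one_div ℂ T 0
    refine ne_top_of_le_ne_top ?_ h
    finiteness
  -- The midpoint between `r(T)` and `1/d_m = r(T) + 1/m`.
  set ρ : ℝ := r + 1 / m / 2 with hρ
  have hρ0 : 0 < ρ := by positivity
  have hlt : spectralRadius ℂ T < ENNReal.ofReal ρ := by
    rw [← ENNReal.ofReal_toReal hfin]
    exact (ENNReal.ofReal_lt_ofReal_iff hρ0).2 (by rw [hρ, hr]; linarith)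
  have hev : ∀ᶠ n : ℕ in atTop, ‖T ^ n‖ ≤ ρ ^ n := by
    filter_upwards [(spectrum.pow_norm_pow_one_div_tendsto_nhds_spectralRadius T).eventually_lt_const
      hlt, eventually_gt_atTop 0] with n hn hn0
    have h1 : ‖T ^ n‖ ^ (1 / n : ℝ) < ρ := (ENNReal.ofReal_lt_ofReal_iff hρ0).1 hn
    have h2 : (‖T ^ n‖ ^ (1 / n : ℝ)) ^ n = ‖T ^ n‖ := by
      rw [one_div, Real.rpow_inv_natCast_pow (norm_nonneg _) hn0.ne']
    rw [← h2]
    gcongr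
  have hdρ : d T m * ρ < 1 := by
    have : d T m = 1 / (1 / m + r) := rfl
    rw [this, one_div_mul_eq_div, div_lt_one (by positivity)]
    linarith
  have hgeom : Summable fun n : ℕ => ((d T m * ρ) ^ 2) ^ n :=
    summable_geometric_of_lt_one (by positivity) (pow_lt_one₀ (by positivity) hdρ two_ne_zero)
  refine hgeom.of_norm_bounded_eventually_nat ?_
  filter_upwards [hev] with n hn
  rw [Real.norm_of_nonneg (by positivity)]
  calc d T m ^ (2 * n) * ‖T ^ n‖ ^ 2 ≤ d T m ^ (2 * n) * (ρ ^ n) ^ 2 := by gcongr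
    _ = ((d T m * ρ) ^ 2) ^ n := by
      rw [← pow_mul, ← pow_mul, mul_pow, mul_comm n 2]

/-- The series `∑ₙ d_m²ⁿ (T*)ⁿ Tⁿ`, whose square root is `R_m`. -/
noncomputable def sqR (T : H →L[ℂ] H) (m : ℕ+) : H →L[ℂ] H :=
  ∑' n : ℕ, (d T m) ^ (2 * n) • (adjoint T ^ n * T ^ n)

theorem hasSum_sqR (T : H →L[ℂ] H) (m : ℕ+) :
    HasSum (fun n : ℕ => (d T m) ^ (2 * n) • (adjoint T ^ n * T ^ n)) (sqR T m) := by
  refine Summable.hasSum (Summable.of_norm_bounded (summable_d_pow_mul_norm_pow_sq T m) fun n => ?_)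
  have hd := d_pos T m
  rw [norm_smul, Real.norm_of_nonneg (by positivity)]
  gcongr
  refine (norm_mul_le _ _).trans_eq ?_
  have : adjoint T ^ n = adjoint (T ^ n) := (star_pow T n).symm
  rw [this, LinearIsometryEquiv.norm_map, sq]

theorem hasSum_inner_sqR (T : H →L[ℂ] H) (m : ℕ+) (h : H) :
    HasSum (fun n : ℕ => ((d T m ^ (2 * n) * ‖(T ^ n) h‖ ^ 2 : ℝ) : ℂ)) ⟪h, sqR T m h⟫_ℂ := by
  refine (((hasSum_sqR T m).mapL (ContinuousLinearMap.apply ℂ H h)).mapL (innerSL ℂ h)).congr_fun ?_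
  intro n
  have : adjoint T ^ n = adjoint (T ^ n) := (star_pow T n).symm
  rw [apply_apply, innerSL_apply_apply, smul_apply, mul_apply_eq_comp, this, inner_smul_right_eq_smul,
    adjoint_inner_right, inner_self_eq_norm_sq_to_K]
  simp

/-- On a complex Hilbert space the quadratic form determines the operator. The term `n = 0` of the
series gives the identity, and the tail is the form of `W*W`. -/
theorem sqR_eq_one_add {T : H →L[ℂ] H} {m : ℕ+} {W : H →L[ℂ] H}
    (hW : ∀ h, HasSum (fun n : ℕ => d T m ^ (2 * (n + 1)) * ‖(T ^ (n + 1)) h‖ ^ 2) (‖W h‖ ^ 2)) :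
    sqR T m = 1 + adjoint W * W := by
  have key : ∀ h, ⟪h, sqR T m h⟫_ℂ = ⟪h, (1 + adjoint W * W) h⟫_ℂ := by
    intro h
    have h1 := ((hasSum_nat_add_iff' 1).2 (hasSum_inner_sqR T m h)).unique
      (RCLike.hasSum_ofReal (𝕜 := ℂ) |>.2 (hW h))
    rw [add_apply, inner_add_right, mul_apply_eq_comp, adjoint_inner_right, inner_self_eq_norm_sq_to_K,
      one_apply_eq_self, inner_self_eq_norm_sq_to_K]
    simp at h1
    rw [sub_eq_iff_eq_add'] at h1
    simpa using h1
  apply ContinuousLinearMap.coe_injective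
  refine (ext_inner_map _ _).1 fun h => ?_
  have := congrArg star (key h)
  simp only [Complex.star_def, inner_conj_symm] at this
  exact this

theorem one_le_sqR {T : H →L[ℂ] H} {m : ℕ+} {W : H →L[ℂ] H}
    (hW : sqR T m = 1 + adjoint W * W) : 1 ≤ sqR T m := by
  rw [hW]
  exact le_add_of_nonneg_right (star_mul_self_nonneg W)

/-- The conjugated operator is `R f ⊗ R⁻¹ g`. From `R² k = g` one gets `R⁻¹ g = R k` and `‖R k‖² =
⟨k, g⟩`, so solving one linear equation replaces computing `R⁻¹`. -/
theorem norm_R_mul_rankOne_mul_inverse_sq {T : H →L[ℂ] H} {m : ℕ+} {W : H →L[ℂ] H}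
    (hW : sqR T m = 1 + adjoint W * W) (f : H) {g k : H} (hk : k + adjoint W (W k) = g) :
    ‖R T m * InnerProductSpace.rankOne ℂ f g * Ring.inverse (R T m)‖ ^ 2
      = (‖f‖ ^ 2 + ‖W f‖ ^ 2) * RCLike.re ⟪k, g⟫_ℂ := by
  have h1 := one_le_sqR hW
  have h0 : 0 ≤ sqR T m := zero_le_one.trans h1
  have hR : R T m = CFC.sqrt (sqR T m) := rfl
  have hRR : R T m * R T m = sqR T m := by rw [hR]; exact CFC.sqrt_mul_sqrt_self _ h0
  have hunit : IsUnit (R T m) := by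
    rw [hR, CFC.isUnit_sqrt_iff _ h0]
    exact CStarAlgebra.isUnit_of_le 1 h1 (by cfc_tac)
  have hsa : adjoint (R T m) = R T m := by
    have : 0 ≤ R T m := by rw [hR]; exact CFC.sqrt_nonneg _
    exact (IsSelfAdjoint.of_nonneg this).star_eq
  have hnorm : ∀ h, ‖R T m h‖ ^ 2 = RCLike.re ⟪h, sqR T m h⟫_ℂ := by
    intro h
    rw [← hRR, mul_apply_eq_comp, ← adjoint_inner_left, hsa, inner_self_eq_norm_sq]
  have hkg : sqR T m k = g := by rw [hW, ← hk]; rfl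
  have hadj : adjoint (Ring.inverse (R T m)) g = R T m k := by
    have h2 : adjoint (Ring.inverse (R T m)) * R T m = 1 := by
      nth_rw 2 [← hsa]
      change star _ * star _ = 1
      rw [← star_mul, Ring.mul_inverse_cancel _ hunit, star_one]
    rw [← hkg, ← hRR, mul_apply_eq_comp, ← mul_apply_eq_comp, h2, one_apply_eq_self]
  have : R T m * InnerProductSpace.rankOne ℂ f g * Ring.inverse (R T m)
      = InnerProductSpace.rankOne ℂ (R T m f) (R T m k) := by
    rw [← hadj]
    ext h
    simp [adjoint_inner_left]
  rw [this, InnerProductSpace.norm_rankOne, mul_pow, hnorm, hnorm, hkg]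
  congr 1
  rw [hW, add_apply, inner_add_right, mul_apply_eq_comp, adjoint_inner_right, one_apply_eq_self, map_add,
    inner_self_eq_norm_sq, inner_self_eq_norm_sq]

end Hilbert
-- Conditional expectation of `[0, ∞]`-valued functions.
section CondExp

open Filter
open scoped ENNReal ComplexConjugate

section LExp

variable {X : Type*} {𝒜 ℱ : MeasurableSpace X} {h𝒜 : 𝒜 ≤ ℱ} {μ : Measure[ℱ] X}
  [SigmaFinite (μ.trim h𝒜)]

include h𝒜

/-- Integrating a conditional expectation against an `𝒜`-measurable weight. -/
theorem lintegral_mul_condLExp {k f : X → ℝ≥0∞} (hk : Measurable[𝒜] k) (hf : AEMeasurable f μ) :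
    ∫⁻ x, k x * condLExp 𝒜 μ f x ∂μ = ∫⁻ x, k x * f x ∂μ := by
  -- Each side integrates `k` against the trace on `𝒜` of a measure with density; the two traces
  -- agree on `𝒜`-sets by the defining property of the conditional expectation.
  have aux : ∀ g : X → ℝ≥0∞, AEMeasurable g μ →
      ∫⁻ x, k x * g x ∂μ = ∫⁻ x, k x ∂((μ.withDensity g).trim h𝒜) := by
    intro g hg
    rw [lintegral_trim h𝒜 hk, lintegral_withDensity_eq_lintegral_mul₀ hg
      (hk.mono h𝒜 le_rfl).aemeasurable]
    simp [mul_comm]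
  rw [aux _ (measurable_condLExp' 𝒜 μ f).aemeasurable, aux _ hf]
  congr 1
  refine @Measure.ext _ 𝒜 _ _ fun s hs => ?_
  rw [trim_measurableSet_eq h𝒜 hs, trim_measurableSet_eq h𝒜 hs, withDensity_apply _ (h𝒜 s hs),
    withDensity_apply _ (h𝒜 s hs), setLIntegral_condLExp h𝒜 μ f hs]

theorem condLExp_mul {k f : X → ℝ≥0∞} (hk : Measurable[𝒜] k) (hf : AEMeasurable f μ) :
    condLExp 𝒜 μ (fun x => k x * f x) =ᵐ[μ] fun x => k x * condLExp 𝒜 μ f x := by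
  refine (ae_eq_condLExp h𝒜 μ _ (hk.mul (measurable_condLExp 𝒜 μ f)) fun s hs => ?_).symm
  have := lintegral_mul_condLExp (h𝒜 := h𝒜) (hk.indicator hs) hf
  rw [← lintegral_indicator (h𝒜 s hs), ← lintegral_indicator (h𝒜 s hs)]
  simp only [← Set.indicator_mul_left] at this
  exact this

/-- A nonnegative function vanishes where its conditional expectation does. -/
theorem ae_eq_zero_of_condLExp_eq_zero {f : X → ℝ≥0∞} (hf : AEMeasurable f μ) :
    ∀ᵐ x ∂μ, condLExp 𝒜 μ f x = 0 → f x = 0 := by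
  set s : Set X := {x | condLExp 𝒜 μ f x = 0} with hs_def
  have hs : MeasurableSet[𝒜] s := measurable_condLExp 𝒜 μ f (measurableSet_singleton 0)
  have h0 : ∫⁻ x in s, f x ∂μ = 0 := by
    rw [← setLIntegral_condLExp h𝒜 μ f hs, setLIntegral_eq_zero_iff (h𝒜 s hs)
      (measurable_condLExp' 𝒜 μ f)]
    exact .of_forall fun x hx => hx
  rw [lintegral_eq_zero_iff' hf.restrict] at h0
  exact (ae_restrict_iff' (h𝒜 s hs)).1 h0

/-- A function with a finite conditional expectation becomes integrable after multiplication by a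
positive `𝒜`-measurable weight. -/
theorem exists_pos_lintegral_mul_lt_top {f : X → ℝ≥0∞} (hf : AEMeasurable f μ)
    (hfin : ∀ᵐ x ∂μ, condLExp 𝒜 μ f x < ∞) :
    ∃ ψ : X → ℝ, Measurable[𝒜] ψ ∧ (∀ x, 0 < ψ x) ∧
      ∫⁻ x, ENNReal.ofReal (ψ x) * f x ∂μ < ∞ := by
  obtain ⟨p, hp0, hpm, hpi⟩ :=
    @exists_pos_lintegral_lt_of_sigmaFinite X 𝒜 (μ.trim h𝒜) _ 1 one_ne_zero
  have hm : Measurable[𝒜] fun x => (condLExp 𝒜 μ f x).toReal :=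
    (measurable_condLExp 𝒜 μ f).ennreal_toReal
  -- Here `p > 0` has finite integral, by σ-finiteness on `𝒜`; dividing by `1 + E(f)` makes `ψ E(f)
  -- ≤ p`.
  have hψ : Measurable[𝒜] fun x => (p x : ℝ) / (1 + (condLExp 𝒜 μ f x).toReal) :=
    hpm.coe_nnreal_real.div (measurable_const.add hm)
  refine ⟨_, hψ, fun x => ?_, ?_⟩
  · have := hp0 x
    positivity
  · rw [← lintegral_mul_condLExp (h𝒜 := h𝒜) hψ.ennreal_ofReal hf]
    rw [lintegral_trim h𝒜 hpm.coe_nnreal_ennreal] at hpi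
    refine (lintegral_mono_ae ?_).trans_lt (hpi.trans ENNReal.one_lt_top)
    filter_upwards [hfin] with x hx
    rw [← ENNReal.ofReal_toReal hx.ne, ENNReal.toReal_ofReal ENNReal.toReal_nonneg,
      ← ENNReal.ofReal_mul (by positivity), ← ENNReal.ofReal_coe_nnreal]
    refine ENNReal.ofReal_le_ofReal ?_
    rw [div_mul_eq_mul_div, div_le_iff₀ (by positivity)]
    gcongr
    linarith

end LExp

/-! ### Conditional expectation of real and complex functions: pull-out and integrability. -/

section CondE

variable {X : Type*} {𝒜 ℱ : MeasurableSpace X} {h𝒜 : 𝒜 ≤ ℱ} {μ : Measure[ℱ] X}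

theorem measurable_condReal (f : X → ℝ) : Measurable[𝒜] (condReal 𝒜 μ f) :=
  (measurable_condLExp 𝒜 μ _).ennreal_toReal.sub (measurable_condLExp 𝒜 μ _).ennreal_toReal

theorem measurable_condE (f : X → ℂ) : Measurable[𝒜] (condE 𝒜 μ f) :=
  (Complex.measurable_ofReal.comp (measurable_condReal _)).add
    ((Complex.measurable_ofReal.comp (measurable_condReal _)).mul_const _)

theorem measurable_condSq (f : X → ℂ) : Measurable[𝒜] (condSq 𝒜 μ f) :=
  measurable_condLExp 𝒜 μ _

theorem condReal_congr {f g : X → ℝ} (h : f =ᵐ[μ] g) : condReal 𝒜 μ f =ᵐ[μ] condReal 𝒜 μ g := by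
  have h1 : condLExp 𝒜 μ (fun y => ENNReal.ofReal (f y)) =ᵐ[μ]
      condLExp 𝒜 μ (fun y => ENNReal.ofReal (g y)) :=
    condLExp_congr_ae (h.mono fun x hx => by simp [hx])
  have h2 : condLExp 𝒜 μ (fun y => ENNReal.ofReal (-f y)) =ᵐ[μ]
      condLExp 𝒜 μ (fun y => ENNReal.ofReal (-g y)) :=
    condLExp_congr_ae (h.mono fun x hx => by simp [hx])
  filter_upwards [h1, h2] with x hx1 hx2
  simp only [condReal, hx1, hx2]

theorem condE_congr {f g : X → ℂ} (h : f =ᵐ[μ] g) : condE 𝒜 μ f =ᵐ[μ] condE 𝒜 μ g := by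
  filter_upwards [condReal_congr (𝒜 := 𝒜) (h.mono fun x hx => congrArg Complex.re hx),
    condReal_congr (𝒜 := 𝒜) (h.mono fun x hx => congrArg Complex.im hx)] with x hx1 hx2
  simp only [condE, hx1, hx2]

theorem Conditionable.of_enorm_le {f : X → ℂ} {g : X → ℝ≥0∞} (hf : AEStronglyMeasurable f μ)
    (hfg : ∀ᵐ x ∂μ, ‖f x‖ₑ ≤ g x) (hg : ∀ᵐ x ∂μ, condLExp 𝒜 μ g x < ∞) :
    Conditionable 𝒜 μ f := by
  refine ⟨hf, ?_⟩
  filter_upwards [condLExp_mono (mΩ := 𝒜) hfg, hg] with x hx1 hx2 using hx1.trans_lt hx2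

/-- The conditional expectation of a nonnegative function. -/
theorem condE_of_nonneg {f : X → ℝ} (hf : ∀ x, 0 ≤ f x) (x : X) :
    condE 𝒜 μ (fun y => (f y : ℂ)) x
      = ((condLExp 𝒜 μ (fun y => ENNReal.ofReal (f y)) x).toReal : ℂ) := by
  have h0 : condLExp 𝒜 μ (fun y => ENNReal.ofReal (-f y)) = 0 := by
    rw [← condLExp_zero μ (mΩ := 𝒜)]
    congr 1
    ext y
    simp [hf y]
  simp [condE, condReal, h0]

variable [SigmaFinite (μ.trim h𝒜)]

include h𝒜

/-- A nonnegative weight scales the positive and negative parts separately. No finiteness is needed,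
since `toReal` is multiplicative even at `∞`. -/
theorem condReal_mul_of_nonneg {ψ f : X → ℝ} (hψ : Measurable[𝒜] ψ) (hψ0 : ∀ x, 0 ≤ ψ x)
    (hf : AEMeasurable f μ) :
    condReal 𝒜 μ (fun x => ψ x * f x) =ᵐ[μ] fun x => ψ x * condReal 𝒜 μ f x := by
  have h1 := condLExp_mul (h𝒜 := h𝒜) hψ.ennreal_ofReal hf.ennreal_ofReal
  have h2 := condLExp_mul (h𝒜 := h𝒜) hψ.ennreal_ofReal hf.neg.ennreal_ofReal
  simp only [Pi.neg_apply] at h2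
  filter_upwards [h1, h2] with x hx1 hx2
  simp only [condReal, ← mul_neg, ENNReal.ofReal_mul (hψ0 _), hx1, hx2, ENNReal.toReal_mul,
    ENNReal.toReal_ofReal (hψ0 x)]
  ring

theorem condE_mul_of_nonneg {ψ : X → ℝ} {f : X → ℂ} (hψ : Measurable[𝒜] ψ) (hψ0 : ∀ x, 0 ≤ ψ x)
    (hf : AEStronglyMeasurable f μ) :
    condE 𝒜 μ (fun x => ψ x * f x) =ᵐ[μ] fun x => ψ x * condE 𝒜 μ f x := by
  have h1 := condReal_mul_of_nonneg (h𝒜 := h𝒜) hψ hψ0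
    (Complex.measurable_re.comp_aemeasurable hf.aemeasurable)
  have h2 := condReal_mul_of_nonneg (h𝒜 := h𝒜) hψ hψ0
    (Complex.measurable_im.comp_aemeasurable hf.aemeasurable)
  simp only [Function.comp_apply] at h1 h2
  filter_upwards [h1, h2] with x hx1 hx2
  simp only [condE, Complex.re_ofReal_mul, Complex.im_ofReal_mul]
  rw [hx1, hx2]
  simp only [Function.comp_def]
  push_cast
  ring

omit h𝒜 [SigmaFinite (μ.trim h𝒜)] in
theorem condReal_of_integrable {f : X → ℝ} (hf : Integrable f μ) :
    condReal 𝒜 μ f =ᵐ[μ] μ[f | 𝒜] := by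
  have h1 : ∀ g : X → ℝ, Integrable g μ → ∫⁻ x, ENNReal.ofReal (g x) ∂μ ≠ ∞ := fun g hg =>
    ((lintegral_mono fun x => Real.ofReal_le_enorm (g x)).trans_lt hg.2).ne
  have hp := toReal_condLExp 𝒜 hf.aemeasurable.ennreal_ofReal (h1 f hf)
  have hn := toReal_condLExp 𝒜 hf.neg.aemeasurable.ennreal_ofReal (h1 _ hf.neg)
  have hs := condExp_sub (μ := μ) hf.real_toNNReal hf.neg.real_toNNReal 𝒜
  have he : (fun x => (Real.toNNReal (f x) : ℝ)) - (fun x => (Real.toNNReal ((-f) x) : ℝ)) = f := by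
    ext x
    simp only [Pi.sub_apply, Pi.neg_apply]
    rw [Real.coe_toNNReal', Real.coe_toNNReal']
    rcases le_total 0 (f x) with h | h <;> simp [h]
  rw [he] at hs
  filter_upwards [hp, hn, hs] with x h2 h3 h4
  rw [h4, Pi.sub_apply]
  exact congrArg₂ _ h2 h3

omit h𝒜 [SigmaFinite (μ.trim h𝒜)] in
theorem condE_of_integrable {f : X → ℂ} (hf : Integrable f μ) :
    condE 𝒜 μ f =ᵐ[μ] μ[f | 𝒜] := by
  filter_upwards [condReal_of_integrable (𝒜 := 𝒜) hf.re, condReal_of_integrable (𝒜 := 𝒜) hf.im,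
    (Complex.reCLM.comp_condExp_comm hf (m := 𝒜)), (Complex.imCLM.comp_condExp_comm hf (m := 𝒜))]
    with x h1 h2 h3 h4
  refine Complex.ext ?_ ?_
  · simpa [condE] using h1.trans h3.symm
  · simpa [condE] using h2.trans h4.symm

/-- Pull-out property of the conditional expectation of a conditionable function. -/
theorem condE_mul {c f : X → ℂ} (hc : Measurable[𝒜] c) (hf : Conditionable 𝒜 μ f) :
    condE 𝒜 μ (fun x => c x * f x) =ᵐ[μ] fun x => c x * condE 𝒜 μ f x := by
  obtain ⟨ψ, hψ, hψ0, hψi⟩ := exists_pos_lintegral_mul_lt_top (h𝒜 := h𝒜) hf.1.enorm hf.2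
  have hψint : Integrable (fun x => (ψ x : ℂ) * f x) μ := by
    refine ⟨((Complex.measurable_ofReal.comp
      (hψ.mono h𝒜 le_rfl)).aestronglyMeasurable).mul hf.1, ?_⟩
    refine (lintegral_mono fun x => ?_).trans_lt hψi
    rw [enorm_mul, ← ofReal_norm (ψ x : ℂ), Complex.norm_of_nonneg (hψ0 x).le]
  have hn : Measurable[𝒜] fun x => 1 + ‖c x‖ :=
    (continuous_const.add continuous_norm).measurable.comp hc
  -- With `b` bounded and `ψ f` integrable, `χ c f = b ψ f` (where `χ = ψ / (1 + |c|)`) falls under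
  -- the pull-out rule for integrable functions; the positive weight `χ` is cancelled at the end.
  set b : X → ℂ := fun x => c x / (1 + ‖c x‖ : ℝ) with hb_def
  have hb : Measurable[𝒜] b := hc.div (Complex.measurable_ofReal.comp hn)
  have hb1 : ∀ x, ‖b x‖ ≤ 1 := by
    intro x
    have : (0 : ℝ) < 1 + ‖c x‖ := by positivity
    rw [hb_def]
    simp only
    rw [norm_div, Complex.norm_of_nonneg this.le, div_le_one this]
    linarith
  have hbint : Integrable (fun x => b x * ((ψ x : ℂ) * f x)) μ :=
    hψint.bdd_mul (hb.mono h𝒜 le_rfl).aestronglyMeasurable (.of_forall hb1)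
  set χ : X → ℝ := fun x => ψ x / (1 + ‖c x‖) with hχ_def
  have hχ : Measurable[𝒜] χ := hψ.div hn
  have hχ0 : ∀ x, 0 < χ x := fun x => by
    have := hψ0 x
    simp only [hχ_def]
    positivity
  have hcf : AEStronglyMeasurable (fun x => c x * f x) μ :=
    (hc.mono h𝒜 le_rfl).aestronglyMeasurable.mul hf.1
  have heq : (fun x => (χ x : ℂ) * (c x * f x)) = fun x => b x * ((ψ x : ℂ) * f x) := by
    ext x
    simp only [hχ_def, hb_def]
    push_cast
    ring
  have e1 := condE_mul_of_nonneg (h𝒜 := h𝒜) hχ (fun x => (hχ0 x).le) hcf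
  rw [heq] at e1
  have e2 := condE_of_integrable (𝒜 := 𝒜) hbint
  have e3 := condExp_bilin_of_stronglyMeasurable_left (m := 𝒜) (ContinuousLinearMap.mul ℝ ℂ)
    hb.stronglyMeasurable hbint hψint
  have e4 := condE_of_integrable (𝒜 := 𝒜) hψint
  have e5 := condE_mul_of_nonneg (h𝒜 := h𝒜) hψ (fun x => (hψ0 x).le) hf.1
  simp only [ContinuousLinearMap.mul_apply'] at e3
  filter_upwards [e1, e2, e3, e4, e5] with x h1 h2 h3 h4 h5
  have hχx : (χ x : ℂ) ≠ 0 := by exact_mod_cast (hχ0 x).ne'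
  refine mul_left_cancel₀ hχx ?_
  rw [← h1, h2, h3, ← h4, h5]
  simp only [hχ_def, hb_def]
  push_cast
  ring

theorem integral_mul_condE {c f : X → ℂ} (hc : Measurable[𝒜] c) (hf : Conditionable 𝒜 μ f)
    (hi : Integrable (fun x => c x * f x) μ) :
    ∫ x, c x * f x ∂μ = ∫ x, c x * condE 𝒜 μ f x ∂μ := by
  rw [← integral_condExp h𝒜]
  exact integral_congr_ae ((condE_of_integrable hi).symm.trans (condE_mul (h𝒜 := h𝒜) hc hf))

omit h𝒜 [SigmaFinite (μ.trim h𝒜)] in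
theorem ofReal_norm_sq (z : ℂ) : ENNReal.ofReal (‖z‖ ^ 2) = ‖z‖ₑ ^ 2 := by
  rw [ENNReal.ofReal_pow (norm_nonneg _), ofReal_norm]

omit h𝒜 [SigmaFinite (μ.trim h𝒜)] in
theorem condE_norm_sq (f : X → ℂ) (x : X) :
    condE 𝒜 μ (fun y => ((‖f y‖ ^ 2 : ℝ) : ℂ)) x = ((condSq 𝒜 μ f x).toReal : ℂ) := by
  rw [condE_of_nonneg fun y => by positivity]
  simp only [ofReal_norm_sq]
  rfl

omit h𝒜 [SigmaFinite (μ.trim h𝒜)] in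
theorem conditionable_norm_sq {f : X → ℂ} (hf : AEStronglyMeasurable f μ)
    (hfin : ∀ᵐ x ∂μ, condSq 𝒜 μ f x < ∞) :
    Conditionable 𝒜 μ fun y => ((‖f y‖ ^ 2 : ℝ) : ℂ) := by
  refine .of_enorm_le (g := fun y => ‖f y‖ₑ ^ 2) ?_ (.of_forall fun x => ?_) hfin
  · exact (Complex.measurable_ofReal.comp_aemeasurable
      (hf.norm.aemeasurable.pow_const 2)).aestronglyMeasurable
  · rw [← ofReal_norm, Complex.norm_of_nonneg (by positivity), ofReal_norm_sq]

omit h𝒜 [SigmaFinite (μ.trim h𝒜)] in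
theorem conditionable_mul {f g : X → ℂ} (hf : AEStronglyMeasurable f μ)
    (hg : AEStronglyMeasurable g μ) (hffin : ∀ᵐ x ∂μ, condSq 𝒜 μ f x < ∞)
    (hgfin : ∀ᵐ x ∂μ, condSq 𝒜 μ g x < ∞) : Conditionable 𝒜 μ fun y => f y * g y := by
  refine .of_enorm_le (g := (fun y => ‖f y‖ₑ ^ 2) + fun y => ‖g y‖ₑ ^ 2) (hf.mul hg)
    (.of_forall fun x => ?_) ?_
  · rw [enorm_mul, Pi.add_apply]
    rcases le_total ‖f x‖ₑ ‖g x‖ₑ with h | h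
    · exact le_add_left (by rw [sq]; gcongr)
    · exact le_add_right (by rw [sq]; gcongr)
  · filter_upwards [condLExp_add_left (mΩ := 𝒜) (fun y => ‖g y‖ₑ ^ 2)
      (hf.enorm.pow_const 2), hffin, hgfin] with x h1 h2 h3
    rw [h1]
    exact ENNReal.add_lt_top.2 ⟨h2, h3⟩

omit h𝒜 [SigmaFinite (μ.trim h𝒜)] in
theorem lintegral_enorm_sq_lt_top {f : X → ℂ} (hf : MemLp f 2 μ) :
    ∫⁻ x, ‖f x‖ₑ ^ 2 ∂μ < ∞ := by
  have := eLpNorm_nnreal_pow_eq_lintegral (μ := μ) (f := f) (p := 2) two_ne_zero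
  simp at this
  rw [← this]
  exact ENNReal.pow_lt_top hf.2

omit h𝒜 [SigmaFinite (μ.trim h𝒜)] in
theorem memLp_two_of_lintegral {f : X → ℂ} (hf : AEStronglyMeasurable f μ)
    (hfin : ∫⁻ x, ‖f x‖ₑ ^ 2 ∂μ < ∞) : MemLp f 2 μ := by
  have := eLpNorm_nnreal_pow_eq_lintegral (μ := μ) (f := f) (p := 2) two_ne_zero
  simp at this
  refine ⟨hf, ?_⟩
  rw [← this] at hfin
  contrapose! hfin
  simp [top_le_iff.1 hfin]

omit h𝒜 [SigmaFinite (μ.trim h𝒜)] in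
theorem norm2_sq (f : X → ℂ) : norm2 μ f ^ 2 = (∫⁻ x, ‖f x‖ₑ ^ 2 ∂μ).toReal := by
  have := eLpNorm_nnreal_pow_eq_lintegral (μ := μ) (f := f) (p := 2) two_ne_zero
  simp at this
  rw [norm2, ← this, ENNReal.toReal_pow]

omit h𝒜 [SigmaFinite (μ.trim h𝒜)] in
theorem condSq_lt_top_of_memLp {f : X → ℂ} (hf : MemLp f 2 μ) :
    ∀ᵐ x ∂μ, condSq 𝒜 μ f x < ∞ :=
  condLExp_lt_top (lintegral_enorm_sq_lt_top hf).ne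

/-- There is a square integrable `h` such that `E(uh)` is positive wherever `E(|u|²)` is. -/
theorem exists_condE_mul_eq {u : X → ℂ} (hu : AEStronglyMeasurable u μ)
    (hfin : ∀ᵐ x ∂μ, condSq 𝒜 μ u x < ∞) :
    ∃ (h : Lp ℂ 2 μ) (ψ : X → ℝ), (∀ x, 0 < ψ x) ∧
      condE 𝒜 μ (fun y => u y * h y) =ᵐ[μ] fun x => ((ψ x * (condSq 𝒜 μ u x).toReal : ℝ) : ℂ) := by
  obtain ⟨ψ, hψ, hψ0, hψi⟩ := exists_pos_lintegral_mul_lt_top (h𝒜 := h𝒜) (hu.enorm.pow_const 2) hfin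
  have hs : Measurable[𝒜] fun x => √(ψ x) := Real.continuous_sqrt.measurable.comp hψ
  -- The test function is `√ψ ū`, for which `E(uh) = √ψ E(|u|²)`; the positive function returned is
  -- thus `√ψ`.
  have hmem : MemLp (fun x => (√(ψ x) : ℂ) * conj (u x)) 2 μ := by
    refine memLp_two_of_lintegral (((Complex.measurable_ofReal.comp
      (hs.mono h𝒜 le_rfl)).aestronglyMeasurable).mul
      (Complex.continuous_conj.comp_aestronglyMeasurable hu)) ?_
    convert hψi using 3 with x
    rw [← ofReal_norm_sq, norm_mul, mul_pow, Complex.norm_of_nonneg (Real.sqrt_nonneg _),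
      Real.sq_sqrt (hψ0 x).le, RCLike.norm_conj, ENNReal.ofReal_mul (hψ0 x).le, ofReal_norm_sq]
  refine ⟨hmem.toLp _, fun x => √(ψ x), fun x => Real.sqrt_pos.2 (hψ0 x), ?_⟩
  have e1 : (fun y => u y * (hmem.toLp _ : X → ℂ) y) =ᵐ[μ] fun y => (√(ψ y) : ℂ) * ((‖u y‖ ^ 2 : ℝ) : ℂ) := by
    filter_upwards [hmem.coeFn_toLp] with y hy
    rw [hy, mul_left_comm, RCLike.mul_conj]
    simp
  filter_upwards [condE_congr (𝒜 := 𝒜) e1, condE_mul_of_nonneg (h𝒜 := h𝒜) hs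
    (fun x => Real.sqrt_nonneg _) (conditionable_norm_sq hu hfin).1] with x h1 h2
  rw [h1, h2, condE_norm_sq]
  push_cast
  rfl

end CondE
end CondExp
-- The powers of `T = M_w E M_u` and the factorisation `R_m² = 1 + W*W`.
section WeightedCondExp

open Filter
open scoped ENNReal ComplexConjugate

variable {X : Type*} {𝒜 ℱ : MeasurableSpace X} {h𝒜 : 𝒜 ≤ ℱ} {μ : Measure[ℱ] X}
  {w u : X → ℂ} {T : Lp ℂ 2 μ →L[ℂ] Lp ℂ 2 μ}

theorem norm_sq_eq_lintegral (f : Lp ℂ 2 μ) : ‖f‖ ^ 2 = (∫⁻ x, ‖f x‖ₑ ^ 2 ∂μ).toReal := by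
  rw [Lp.norm_def]
  exact norm2_sq f

theorem ofReal_norm_sq_eq_lintegral (f : Lp ℂ 2 μ) :
    ENNReal.ofReal (‖f‖ ^ 2) = ∫⁻ x, ‖f x‖ₑ ^ 2 ∂μ := by
  rw [norm_sq_eq_lintegral, ENNReal.ofReal_toReal (lintegral_enorm_sq_lt_top (Lp.memLp f)).ne]

theorem condE_zero (x : X) : condE 𝒜 μ (fun _ => 0) x = 0 := by
  simp [condE, condReal]

variable [SigmaFinite (μ.trim h𝒜)]

include h𝒜

/-- If `M_w E M_u` is bounded then `u` vanishes wherever `E(|w|²)` is infinite. -/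
theorem eq_zero_of_condSq_eq_top (hw : AEStronglyMeasurable w μ) (hu : AEStronglyMeasurable u μ)
    (hu2 : ∀ᵐ x ∂μ, condSq 𝒜 μ u x < ∞)
    (hT : ∀ h : Lp ℂ 2 μ, T h =ᵐ[μ] fun x => w x * condE 𝒜 μ (fun y => u y * h y) x) :
    ∀ᵐ x ∂μ, condSq 𝒜 μ w x = ∞ → u x = 0 := by
  obtain ⟨h, ψ, hψ, hh⟩ := exists_condE_mul_eq (h𝒜 := h𝒜) hu hu2
  have hk : Measurable[𝒜] fun x => ‖condE 𝒜 μ (fun y => u y * h y) x‖ₑ ^ 2 :=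
    ((continuous_enorm.measurable.comp (measurable_condE _)).pow_const 2)
  -- The integral equals `‖T h‖²`, so `E(|w|²)` is finite almost everywhere that `E(uh) ≠ 0`, which
  -- covers almost every point with `u ≠ 0`.
  have hfin : ∫⁻ x, ‖condE 𝒜 μ (fun y => u y * h y) x‖ₑ ^ 2 * condSq 𝒜 μ w x ∂μ < ∞ := by
    unfold condSq
    rw [lintegral_mul_condLExp (h𝒜 := h𝒜) hk (hw.enorm.pow_const 2)]
    refine (lintegral_congr_ae ?_).trans_lt (lintegral_enorm_sq_lt_top (Lp.memLp (T h)))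
    filter_upwards [hT h] with x hx
    rw [hx, enorm_mul, mul_pow, mul_comm]
  have hlt := ae_lt_top ((hk.mono h𝒜 le_rfl).mul ((measurable_condSq w).mono h𝒜 le_rfl)) hfin.ne
  filter_upwards [hlt, hh, hu2, ae_eq_zero_of_condLExp_eq_zero (h𝒜 := h𝒜)
    (hu.enorm.pow_const 2)] with x h1 h2 h3 h4 h5
  by_contra hux
  have h6 : condSq 𝒜 μ u x ≠ 0 := fun h6 => hux (by simpa using h4 h6)
  have h7 : 0 < (condSq 𝒜 μ u x).toReal := ENNReal.toReal_pos h6 h3.ne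
  rw [Pi.mul_apply, h5, ENNReal.mul_top] at h1
  · exact h1.ne rfl
  · have := mul_pos (hψ x) h7
    rw [h2]
    simpa using this.ne'

/-- Each further application of `T` to `w` times an `𝒜`-measurable function pulls that function out
and leaves one more factor `E(uw)`. -/
theorem pow_succ_apply_ae (huw : Conditionable 𝒜 μ fun y => u y * w y)
    (hT : ∀ h : Lp ℂ 2 μ, T h =ᵐ[μ] fun x => w x * condE 𝒜 μ (fun y => u y * h y) x)
    (h : Lp ℂ 2 μ) (n : ℕ) :
    (T ^ (n + 1)) h =ᵐ[μ] fun x => condE 𝒜 μ (fun y => u y * w y) x ^ n * T h x := by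
  induction n with
  | zero => simp
  | succ n ih =>
    have e1 : (fun y => u y * (T ^ (n + 1)) h y) =ᵐ[μ] fun y =>
        (condE 𝒜 μ (fun y => u y * w y) y ^ n * condE 𝒜 μ (fun y => u y * h y) y)
          * (u y * w y) := by
      filter_upwards [ih, hT h] with y h1 h2
      rw [h1, h2]
      ring
    have e2 := condE_mul (h𝒜 := h𝒜) 
      (((measurable_condE (μ := μ) fun y => u y * w y).pow_const n).mul
        (measurable_condE (μ := μ) fun y => u y * h y)) huw
    have e3 := hT ((T ^ (n + 1)) h)
    rw [pow_succ' T (n + 1)]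
    filter_upwards [e3, condE_congr (𝒜 := 𝒜) e1, e2, hT h] with x h1 h2 h3 h4
    rw [mul_apply_eq_comp, h1, h2]
    simp only [Pi.mul_apply] at h3
    rw [h3, h4]
    ring

/-- Tonelli in `[0, ∞]`: the geometric series is not assumed to converge, so the identity can serve
to prove that its ratio is below `1`. -/
theorem tsum_norm_pow_sq (huw : Conditionable 𝒜 μ fun y => u y * w y)
    (hT : ∀ h : Lp ℂ 2 μ, T h =ᵐ[μ] fun x => w x * condE 𝒜 μ (fun y => u y * h y) x)
    (h : Lp ℂ 2 μ) {d : ℝ} (hd : 0 < d) :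
    ∑' n : ℕ, ENNReal.ofReal (d ^ (2 * (n + 1)) * ‖(T ^ (n + 1)) h‖ ^ 2)
      = ∫⁻ x, (∑' n : ℕ, ENNReal.ofReal
          (d ^ 2 * (d ^ 2 * ‖condE 𝒜 μ (fun y => u y * w y) x‖ ^ 2) ^ n)) * ‖T h x‖ₑ ^ 2 ∂μ := by
  simp_rw [← ENNReal.tsum_mul_right]
  rw [lintegral_tsum]
  · refine tsum_congr fun n => ?_
    rw [ENNReal.ofReal_mul (by positivity), ofReal_norm_sq_eq_lintegral,
      ← lintegral_const_mul'' _ ((Lp.aestronglyMeasurable _).enorm.pow_const 2)]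
    refine lintegral_congr_ae ?_
    filter_upwards [pow_succ_apply_ae (h𝒜 := h𝒜) huw hT h n] with x hx
    rw [hx, ← ofReal_norm_sq, ← ofReal_norm_sq, ← ENNReal.ofReal_mul (by positivity),
      ← ENNReal.ofReal_mul (by positivity), norm_mul, norm_pow]
    congr 1
    ring
  · intro n
    have hK : Measurable fun x => ‖condE 𝒜 μ (fun y => u y * w y) x‖ :=
      ((measurable_condE fun y => u y * w y).mono h𝒜 le_rfl).norm
    exact ((((hK.pow_const 2).const_mul _).pow_const n).const_mul _).ennreal_ofReal.aemeasurable.mul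
      ((Lp.aestronglyMeasurable _).enorm.pow_const 2)

omit h𝒜 [SigmaFinite (μ.trim h𝒜)] in
theorem summable_norm_pow_succ_apply_sq (T : Lp ℂ 2 μ →L[ℂ] Lp ℂ 2 μ) (m : ℕ+) (h : Lp ℂ 2 μ) :
    Summable fun n : ℕ => d T m ^ (2 * (n + 1)) * ‖(T ^ (n + 1)) h‖ ^ 2 := by
  have hd := d_pos T m
  refine .of_nonneg_of_le (fun n => by positivity) (fun n => ?_)
    (((summable_nat_add_iff 1).2 (summable_d_pow_mul_norm_pow_sq T m)).mul_right (‖h‖ ^ 2))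
  rw [mul_assoc, ← mul_pow]
  gcongr
  exact ContinuousLinearMap.le_opNorm _ _

/-- `|E(uw)| < 1 / d_m` almost everywhere. -/
theorem d_mul_norm_condE_lt_one (hu : AEStronglyMeasurable u μ)
    (hu2 : ∀ᵐ x ∂μ, condSq 𝒜 μ u x < ∞)
    (huw : Conditionable 𝒜 μ fun y => u y * w y)
    (hT : ∀ h : Lp ℂ 2 μ, T h =ᵐ[μ] fun x => w x * condE 𝒜 μ (fun y => u y * h y) x)
    (m : ℕ+) :
    ∀ᵐ x ∂μ, d T m ^ 2 * ‖condE 𝒜 μ (fun y => u y * w y) x‖ ^ 2 < 1 := by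
  have hd := d_pos T m
  have hK : Measurable[𝒜] fun x => ‖condE 𝒜 μ (fun y => u y * w y) x‖ :=
    continuous_norm.measurable.comp (measurable_condE fun y => u y * w y)
  obtain ⟨h, ψ, hψ, hh⟩ := exists_condE_mul_eq (h𝒜 := h𝒜) hu hu2
  have hfin := tsum_norm_pow_sq (h𝒜 := h𝒜) huw hT h hd
  rw [← ENNReal.ofReal_tsum_of_nonneg (fun n => by positivity)
    (summable_norm_pow_succ_apply_sq T m h)] at hfin
  have hm : AEMeasurable (fun x => (∑' n : ℕ, ENNReal.ofReal
      (d T m ^ 2 * (d T m ^ 2 * ‖condE 𝒜 μ (fun y => u y * w y) x‖ ^ 2) ^ n)) * ‖T h x‖ₑ ^ 2) μ := by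
    refine AEMeasurable.mul (Measurable.aemeasurable (Measurable.tsum fun n => ?_))
      ((Lp.aestronglyMeasurable _).enorm.pow_const 2)
    exact ((((hK.mono h𝒜 le_rfl).pow_const 2).const_mul _).pow_const n).const_mul _
      |>.ennreal_ofReal
  have hlt := ae_lt_top' hm (by rw [← hfin]; exact ENNReal.ofReal_ne_top)
  set A : Set X := {x | 1 ≤ d T m ^ 2 * ‖condE 𝒜 μ (fun y => u y * w y) x‖ ^ 2} with hA_def
  have hA : MeasurableSet[𝒜] A :=
    (hK.pow_const 2).const_mul (d T m ^ 2) measurableSet_Ici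
  -- On `A` the geometric series diverges while the integral is finite, so `T h = 0` there. As
  -- `E(uh) ≠ 0` wherever `u ≠ 0`, this forces `uw = 0`.
  have hzero : ∀ᵐ x ∂μ, x ∈ A → u x * w x = 0 := by
    filter_upwards [hlt, hh, hu2, hT h, ae_eq_zero_of_condLExp_eq_zero (h𝒜 := h𝒜)
      (hu.enorm.pow_const 2)] with x h1 h2 h3 h4 h5 hxA
    by_contra hux
    obtain ⟨hux, hwx⟩ := mul_ne_zero_iff.1 hux
    have h6 : condSq 𝒜 μ u x ≠ 0 := fun h6 => hux (by simpa using h5 h6)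
    have h7 : 0 < (condSq 𝒜 μ u x).toReal := ENNReal.toReal_pos h6 h3.ne
    have h8 : T h x ≠ 0 := by
      rw [h4, h2]
      have := mul_pos (hψ x) h7
      exact mul_ne_zero hwx (by exact_mod_cast this.ne')
    have h9 : ∑' n : ℕ, ENNReal.ofReal
        (d T m ^ 2 * (d T m ^ 2 * ‖condE 𝒜 μ (fun y => u y * w y) x‖ ^ 2) ^ n) = ∞ := by
      rw [← top_le_iff, ← ENNReal.tsum_const_eq_top_of_ne_zero (α := ℕ)
        (c := ENNReal.ofReal (d T m ^ 2)) (by simp; positivity)]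
      refine ENNReal.tsum_le_tsum fun n => ENNReal.ofReal_le_ofReal ?_
      exact le_mul_of_one_le_right (by positivity) (one_le_pow₀ hxA)
    rw [h9, ENNReal.top_mul (by simpa using h8)] at h1
    exact h1.ne rfl
  -- Pulling out the indicator of `A` gives `E(uw) = 0` on `A`, contradicting the definition of `A`;
  -- so `A` is null.
  have hc : Measurable[𝒜] (A.indicator fun _ => (1 : ℂ)) := measurable_const.indicator hA
  have e1 := condE_mul (h𝒜 := h𝒜) hc huw
  have e2 : (fun x => A.indicator (fun _ => (1 : ℂ)) x * (u x * w x)) =ᵐ[μ] fun _ => 0 := by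
    filter_upwards [hzero] with x hx
    by_cases hxA : x ∈ A
    · simp [hx hxA]
    · simp [hxA]
  filter_upwards [e1, condE_congr (𝒜 := 𝒜) e2] with x h1 h2
  by_contra hx
  have hxA : x ∈ A := not_lt.1 hx
  rw [h2, condE_zero, Set.indicator_of_mem hxA, one_mul] at h1
  rw [← h1] at hx
  simp at hx

/-- The squared weight is the sum of the geometric series, so `‖W h‖²` is the tail of the series for
`⟨h, R_m² h⟩`. Boundedness of `W` comes from that series, with no bound on the weight itself. -/
theorem exists_sqrt_weight_mul (hu : AEStronglyMeasurable u μ)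
    (hu2 : ∀ᵐ x ∂μ, condSq 𝒜 μ u x < ∞)
    (huw : Conditionable 𝒜 μ fun y => u y * w y)
    (hT : ∀ h : Lp ℂ 2 μ, T h =ᵐ[μ] fun x => w x * condE 𝒜 μ (fun y => u y * h y) x)
    (m : ℕ+) :
    ∃ W : Lp ℂ 2 μ →L[ℂ] Lp ℂ 2 μ, sqR T m = 1 + ContinuousLinearMap.adjoint W * W ∧
      ∀ h, W h =ᵐ[μ] fun x => (√(d T m ^ 2 /
        (1 - d T m ^ 2 * ‖condE 𝒜 μ (fun y => u y * w y) x‖ ^ 2)) : ℂ) * T h x := by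
  have hd := d_pos T m
  set p : X → ℝ := fun x => d T m ^ 2 /
    (1 - d T m ^ 2 * ‖condE 𝒜 μ (fun y => u y * w y) x‖ ^ 2) with hp
  have hpm : Measurable p := by
    have hK : Measurable fun x => ‖condE 𝒜 μ (fun y => u y * w y) x‖ :=
      ((measurable_condE fun y => u y * w y).mono h𝒜 le_rfl).norm
    exact measurable_const.div (measurable_const.sub ((hK.pow_const 2).const_mul _))
  have hint : ∀ h : Lp ℂ 2 μ, ∫⁻ x, ‖(√(p x) : ℂ) * T h x‖ₑ ^ 2 ∂μ
      = ∑' n : ℕ, ENNReal.ofReal (d T m ^ (2 * (n + 1)) * ‖(T ^ (n + 1)) h‖ ^ 2) := by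
    intro h
    rw [tsum_norm_pow_sq (h𝒜 := h𝒜) huw hT h hd]
    refine lintegral_congr_ae ?_
    filter_upwards [d_mul_norm_condE_lt_one (h𝒜 := h𝒜) hu hu2 huw hT m] with x hx
    have h0 : 0 ≤ d T m ^ 2 * ‖condE 𝒜 μ (fun y => u y * w y) x‖ ^ 2 := by positivity
    have hp0 : 0 ≤ p x := div_nonneg (by positivity) (by linarith)
    rw [← ENNReal.ofReal_tsum_of_nonneg (fun n => by positivity)
      ((summable_geometric_of_lt_one h0 hx).mul_left _), tsum_mul_left,
      tsum_geometric_of_lt_one h0 hx, ← ofReal_norm_sq, norm_mul, mul_pow,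
      Complex.norm_of_nonneg (Real.sqrt_nonneg _), Real.sq_sqrt hp0, ENNReal.ofReal_mul hp0,
      ofReal_norm_sq]
    rfl
  have hmem : ∀ h : Lp ℂ 2 μ, MemLp (fun x => (√(p x) : ℂ) * T h x) 2 μ := by
    intro h
    refine memLp_two_of_lintegral ((Complex.measurable_ofReal.comp
      (Real.continuous_sqrt.measurable.comp hpm)).aestronglyMeasurable.mul
      (Lp.aestronglyMeasurable _)) ?_
    rw [hint, ← ENNReal.ofReal_tsum_of_nonneg (fun n => by positivity)
      (summable_norm_pow_succ_apply_sq T m h)]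
    exact ENNReal.ofReal_lt_top
  let W₀ : Lp ℂ 2 μ →ₗ[ℂ] Lp ℂ 2 μ :=
    { toFun := fun h => (hmem h).toLp _
      map_add' := fun h h' => by
        rw [← MemLp.toLp_add]
        refine MemLp.toLp_congr _ _ ?_
        filter_upwards [Lp.coeFn_add (T h) (T h')] with x hx
        rw [map_add, hx]
        exact mul_add _ _ _
      map_smul' := fun c h => by
        rw [RingHom.id_apply, ← MemLp.toLp_const_smul]
        refine MemLp.toLp_congr _ _ ?_
        filter_upwards [Lp.coeFn_smul c (T h)] with x hx
        rw [map_smul, hx]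
        exact mul_left_comm _ _ _ }
  have hW₀ : ∀ h, W₀ h =ᵐ[μ] fun x => (√(p x) : ℂ) * T h x := fun h => (hmem h).coeFn_toLp
  have hsum : ∀ h, HasSum (fun n : ℕ => d T m ^ (2 * (n + 1)) * ‖(T ^ (n + 1)) h‖ ^ 2)
      (‖W₀ h‖ ^ 2) := by
    intro h
    have h1 := summable_norm_pow_succ_apply_sq T m h
    convert h1.hasSum
    rw [norm_sq_eq_lintegral, lintegral_congr_ae ((hW₀ h).mono fun x hx => by rw [hx]), hint,
      ← ENNReal.ofReal_tsum_of_nonneg (fun n => by positivity) h1,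
      ENNReal.toReal_ofReal (tsum_nonneg fun n => by positivity)]
  have hbd : ∃ C, ∀ h, ‖W₀ h‖ ≤ C * ‖h‖ := by
    have hs := (summable_nat_add_iff 1).2 (summable_d_pow_mul_norm_pow_sq T m)
    refine ⟨√(∑' n : ℕ, d T m ^ (2 * (n + 1)) * ‖T ^ (n + 1)‖ ^ 2), fun h => ?_⟩
    refine abs_le_of_sq_le_sq' ?_ (by positivity) |>.2
    rw [mul_pow, Real.sq_sqrt (tsum_nonneg fun n => by positivity), ← (hsum h).tsum_eq,
      ← tsum_mul_right]
    refine (hsum h).summable.tsum_le_tsum (fun n => ?_) (hs.mul_right _)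
    rw [mul_assoc, ← mul_pow]
    gcongr
    exact ContinuousLinearMap.le_opNorm _ _
  refine ⟨W₀.mkContinuousOfExistsBound hbd, sqR_eq_one_add fun h => ?_, hW₀⟩
  exact hsum h

end WeightedCondExp
-- The weights `v` and `α`, and the exact norm of `R_m (f ⊗ g) R_m⁻¹`.
section Main

open Filter ContinuousLinearMap
open scoped ENNReal ComplexConjugate InnerProductSpace

variable {X : Type*} {𝒜 ℱ : MeasurableSpace X} {h𝒜 : 𝒜 ≤ ℱ} {μ : Measure[ℱ] X}
  {w u : X → ℂ} {T : Lp ℂ 2 μ →L[ℂ] Lp ℂ 2 μ}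

theorem measurable_v (w u : X → ℂ) (d : ℝ) : Measurable[𝒜] (v 𝒜 μ w u d) := by
  have hK : Measurable[𝒜] fun x => ‖condE 𝒜 μ (fun y => u y * w y) x‖ :=
    continuous_norm.measurable.comp (measurable_condE fun y => u y * w y)
  exact ((measurable_condSq w).ennreal_toReal.const_mul _).div
    (measurable_const.sub ((hK.pow_const 2).const_mul _))

theorem measurable_α (w u : X → ℂ) (d : ℝ) : Measurable[𝒜] (α 𝒜 μ w u d) :=
  (measurable_v w u d).div
    (measurable_const.add ((measurable_v w u d).mul (measurable_condSq u).ennreal_toReal))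

theorem measurable_weighted {a : X → ℝ} (ha : Measurable[𝒜] a) (u f : X → ℂ) :
    Measurable[𝒜] (weighted 𝒜 μ a u f) :=
  (Complex.measurable_ofReal.comp (Real.continuous_sqrt.measurable.comp ha)).mul
    (measurable_condE _)

theorem v_nonneg {d : ℝ} {x : X}
    (hx : d ^ 2 * ‖condE 𝒜 μ (fun y => u y * w y) x‖ ^ 2 < 1) : 0 ≤ v 𝒜 μ w u d x :=
  div_nonneg (by positivity) (by linarith)

theorem α_nonneg {d : ℝ} {x : X} (hv : 0 ≤ v 𝒜 μ w u d x) : 0 ≤ α 𝒜 μ w u d x := by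
  unfold α
  positivity

theorem α_le_v {d : ℝ} {x : X} (hv : 0 ≤ v 𝒜 μ w u d x) : α 𝒜 μ w u d x ≤ v 𝒜 μ w u d x :=
  div_le_self hv (by simp; positivity)

/-- This scalar identity is what singles out `α`: it is the condition for `g - α E(ug) ū` to solve
`(1 + W*W) k = g`. -/
theorem one_sub_α_mul_mul_v {d : ℝ} {x : X} (hv : 0 ≤ v 𝒜 μ w u d x) :
    (1 - α 𝒜 μ w u d x * (condSq 𝒜 μ u x).toReal) * v 𝒜 μ w u d x = α 𝒜 μ w u d x := by
  have : 0 < 1 + v 𝒜 μ w u d x * (condSq 𝒜 μ u x).toReal := by positivity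
  unfold α
  field_simp
  ring

theorem α_mul_le_one {d : ℝ} {x : X} (hv : 0 ≤ v 𝒜 μ w u d x) :
    α 𝒜 μ w u d x * (condSq 𝒜 μ u x).toReal ≤ 1 := by
  have : 0 < 1 + v 𝒜 μ w u d x * (condSq 𝒜 μ u x).toReal := by positivity
  unfold α
  rw [div_mul_eq_mul_div, div_le_one this]
  linarith

theorem enorm_weighted_sq {a : X → ℝ} {x : X} (ha : 0 ≤ a x) (f : X → ℂ) :
    ‖weighted 𝒜 μ a u f x‖ₑ ^ 2
      = ENNReal.ofReal (a x * ‖condE 𝒜 μ (fun y => u y * f y) x‖ ^ 2) := by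
  rw [← ofReal_norm_sq, weighted, norm_mul, mul_pow, Complex.norm_of_nonneg (Real.sqrt_nonneg _),
    Real.sq_sqrt ha]

variable [SigmaFinite (μ.trim h𝒜)]

include h𝒜

/-- The weight `v` computes the norm of `φ T h`, where `φ² = d² / (1 - d² |E(uw)|²)`. -/
theorem lintegral_weighted_v (hw : AEStronglyMeasurable w μ)
    (hw2 : ∀ᵐ x ∂μ, condSq 𝒜 μ w x < ∞) {d : ℝ}
    (hK : ∀ᵐ x ∂μ, d ^ 2 * ‖condE 𝒜 μ (fun y => u y * w y) x‖ ^ 2 < 1)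
    {h k : Lp ℂ 2 μ}
    (hk : k =ᵐ[μ] fun x => (√(d ^ 2 /
        (1 - d ^ 2 * ‖condE 𝒜 μ (fun y => u y * w y) x‖ ^ 2)) : ℂ) *
          (w x * condE 𝒜 μ (fun y => u y * h y) x)) :
    ∫⁻ x, ‖weighted 𝒜 μ (v 𝒜 μ w u d) u h x‖ₑ ^ 2 ∂μ = ∫⁻ x, ‖k x‖ₑ ^ 2 ∂μ := by
  have hKm : ∀ f : X → ℂ, Measurable[𝒜] fun x => ‖condE 𝒜 μ (fun y => u y * f y) x‖ :=
    fun f => continuous_norm.measurable.comp (measurable_condE fun y => u y * f y)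
  set p : X → ℝ := fun x => d ^ 2 / (1 - d ^ 2 * ‖condE 𝒜 μ (fun y => u y * w y) x‖ ^ 2) with hp
  have hpm : Measurable[𝒜] p :=
    measurable_const.div (measurable_const.sub (((hKm w).pow_const 2).const_mul _))
  have := lintegral_mul_condLExp (h𝒜 := h𝒜)
    ((hpm.mul ((hKm h).pow_const 2)).ennreal_ofReal) (hw.enorm.pow_const 2)
  refine (lintegral_congr_ae ?_).trans (this.trans (lintegral_congr_ae ?_))
  · filter_upwards [hK, hw2] with x h1 h2
    have hp0 : 0 ≤ p x := div_nonneg (by positivity) (by linarith)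
    rw [enorm_weighted_sq (v_nonneg h1)]
    change _ = _ * condSq 𝒜 μ w x
    rw [← ENNReal.ofReal_toReal h2.ne, Pi.mul_apply, ← ENNReal.ofReal_mul (by positivity)]
    congr 1
    simp only [v, hp]
    ring
  · filter_upwards [hK, hk] with x h1 h2
    have hp0 : 0 ≤ p x := div_nonneg (by positivity) (by linarith)
    rw [h2, ← ofReal_norm_sq, ← ofReal_norm_sq, Pi.mul_apply, ← ENNReal.ofReal_mul (by positivity),
      norm_mul, norm_mul, mul_pow, mul_pow, Complex.norm_of_nonneg (Real.sqrt_nonneg _)]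
    change _ = ENNReal.ofReal (√(p x) ^ 2 * _)
    rw [Real.sq_sqrt hp0]
    congr 1
    ring

-- Everything reduces to exhibiting the solution `k = g - q`, `q = α E(ug) ū`, of `(1 + W*W) k = g`,
-- and reading off `⟨q, g⟩ = ‖α^(1/2) E(ug)‖²`.
set_option maxHeartbeats 1000000 in
theorem norm_R_mul_rankOne_mul_inverse_sq_eq (hw : AEStronglyMeasurable w μ)
    (hu : AEStronglyMeasurable u μ) (hw2 : ∀ᵐ x ∂μ, condSq 𝒜 μ w x < ∞)
    (hu2 : ∀ᵐ x ∂μ, condSq 𝒜 μ u x < ∞)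
    (hT : ∀ h : Lp ℂ 2 μ, T h =ᵐ[μ] fun x => w x * condE 𝒜 μ (fun y => u y * h y) x)
    (m : ℕ+) (f g : Lp ℂ 2 μ) :
    MemLp (weighted 𝒜 μ (v 𝒜 μ w u (d T m)) u f) 2 μ ∧
    MemLp (weighted 𝒜 μ (α 𝒜 μ w u (d T m)) u g) 2 μ ∧
    ‖R T m * InnerProductSpace.rankOne ℂ f g * Ring.inverse (R T m)‖ ^ 2
      = (‖f‖ ^ 2 + norm2 μ (weighted 𝒜 μ (v 𝒜 μ w u (d T m)) u f) ^ 2) *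
        (‖g‖ ^ 2 - norm2 μ (weighted 𝒜 μ (α 𝒜 μ w u (d T m)) u g) ^ 2) := by
  have huw := conditionable_mul hu hw hu2 hw2
  have hcond : ∀ h : Lp ℂ 2 μ, Conditionable 𝒜 μ fun y => u y * h y := fun h =>
    conditionable_mul hu (Lp.aestronglyMeasurable h) hu2 (condSq_lt_top_of_memLp (Lp.memLp h))
  have hK := d_mul_norm_condE_lt_one (h𝒜 := h𝒜) hu hu2 huw hT m
  obtain ⟨W, hWsq, hW⟩ := exists_sqrt_weight_mul (h𝒜 := h𝒜) hu hu2 huw hT m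
  set D := d T m
  have hWl : ∀ h : Lp ℂ 2 μ, ∫⁻ x, ‖weighted 𝒜 μ (v 𝒜 μ w u D) u h x‖ₑ ^ 2 ∂μ = ∫⁻ x, ‖W h x‖ₑ ^ 2 ∂μ :=
    fun h => lintegral_weighted_v (h𝒜 := h𝒜) hw hw2 hK (by
      filter_upwards [hW h, hT h] with x h1 h2
      rw [h1, h2])
  have hvm := measurable_v (𝒜 := 𝒜) (μ := μ) w u D
  have hαm := measurable_α (𝒜 := 𝒜) (μ := μ) w u D
  have hWfin : ∀ h : Lp ℂ 2 μ, ∫⁻ x, ‖weighted 𝒜 μ (v 𝒜 μ w u D) u h x‖ₑ ^ 2 ∂μ < ∞ := fun h =>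
    (hWl h).trans_lt (lintegral_enorm_sq_lt_top (Lp.memLp _))
  have hαfin : ∫⁻ x, ‖weighted 𝒜 μ (α 𝒜 μ w u D) u g x‖ₑ ^ 2 ∂μ < ∞ := by
    refine (lintegral_mono_ae ?_).trans_lt (hWfin g)
    filter_upwards [hK] with x hx
    have hv := v_nonneg hx
    rw [enorm_weighted_sq hv, enorm_weighted_sq (α_nonneg hv)]
    gcongr
    exact α_le_v hv
  set Eg := condE 𝒜 μ (fun y => u y * g y) with hEg
  have hEgm : Measurable[𝒜] Eg := measurable_condE _
  set M : X → ℝ := fun x => (condSq 𝒜 μ u x).toReal with hM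
  have hMm : Measurable[𝒜] M := (measurable_condSq u).ennreal_toReal
  set a := α 𝒜 μ w u D with ha
  have hac : Measurable[𝒜] fun x => (a x : ℂ) := Complex.measurable_ofReal.comp hαm
  -- Conditioning `|u|²` turns `|q|²` into `α² |E(ug)|² E(|u|²)`, at most `α |E(ug)|²` because `α
  -- E(|u|²) ≤ 1`.
  have hqm : MemLp (fun x => (a x : ℂ) * Eg x * conj (u x)) 2 μ := by
    refine memLp_two_of_lintegral (((hac.mul hEgm).mono h𝒜 le_rfl).aestronglyMeasurable.mul
      (Complex.continuous_conj.comp_aestronglyMeasurable hu)) ?_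
    have hk : Measurable[𝒜] fun x => ENNReal.ofReal ((a x) ^ 2 * ‖Eg x‖ ^ 2) :=
      ((hαm.pow_const 2).mul
        ((continuous_norm.measurable.comp hEgm).pow_const 2)).ennreal_ofReal
    have := lintegral_mul_condLExp (h𝒜 := h𝒜) hk (hu.enorm.pow_const 2)
    refine ((lintegral_congr fun x => ?_).trans this.symm).trans_lt
      ((lintegral_mono_ae ?_).trans_lt hαfin)
    · rw [← ofReal_norm_sq, ← ofReal_norm_sq, ← ENNReal.ofReal_mul (by positivity), norm_mul,
        norm_mul, RCLike.norm_conj, mul_pow, mul_pow, Complex.norm_real, Real.norm_eq_abs, sq_abs]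
    · filter_upwards [hK, hu2] with x h1 h2
      have hv := v_nonneg h1
      have hα := α_nonneg hv
      rw [enorm_weighted_sq hα]
      change _ * condSq 𝒜 μ u x ≤ _
      rw [← ENNReal.ofReal_toReal h2.ne, ← ENNReal.ofReal_mul (by positivity)]
      refine ENNReal.ofReal_le_ofReal ?_
      calc a x ^ 2 * ‖Eg x‖ ^ 2 * (condSq 𝒜 μ u x).toReal
          = a x * ‖Eg x‖ ^ 2 * (a x * (condSq 𝒜 μ u x).toReal) := by ring
        _ ≤ a x * ‖Eg x‖ ^ 2 * 1 := by
          have : 0 ≤ a x := hα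
          gcongr
          exact α_mul_le_one hv
        _ = _ := mul_one _
  set q : Lp ℂ 2 μ := hqm.toLp _ with hq_def
  have hq : q =ᵐ[μ] fun x => (a x : ℂ) * Eg x * conj (u x) := hqm.coeFn_toLp
  have hqinner : ∀ h : Lp ℂ 2 μ, ⟪q, h⟫_ℂ
      = ∫ x, (a x : ℂ) * conj (Eg x) * condE 𝒜 μ (fun y => u y * h y) x ∂μ := by
    intro h
    have e1 : (fun x => ⟪q x, h x⟫_ℂ) =ᵐ[μ] fun x => ((a x : ℂ) * conj (Eg x)) * (u x * h x) := by
      filter_upwards [hq] with x hx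
      rw [hx, RCLike.inner_apply]
      simp only [map_mul, RCLike.conj_conj, Complex.conj_ofReal]
      ring
    rw [L2.inner_def, integral_congr_ae e1]
    exact integral_mul_condE (h𝒜 := h𝒜)
      (hac.mul (Complex.continuous_conj.measurable.comp hEgm)) (hcond h)
      ((L2.integrable_inner q h).congr e1)
  have hTq : T q =ᵐ[μ] fun x => ((a x * M x : ℝ) : ℂ) * T g x := by
    have e1 : (fun y => u y * q y) =ᵐ[μ] fun y =>
        ((a y : ℂ) * Eg y) * ((‖u y‖ ^ 2 : ℝ) : ℂ) := by
      filter_upwards [hq] with y hy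
      rw [hy, mul_left_comm, RCLike.mul_conj]
      simp
    filter_upwards [hT q, hT g, condE_congr (𝒜 := 𝒜) e1,
      condE_mul (h𝒜 := h𝒜) (hac.mul hEgm) (conditionable_norm_sq hu hu2)] with x h1 h2 h3 h4
    simp only [Pi.mul_apply] at h4
    rw [h1, h2, h3, h4, condE_norm_sq]
    push_cast
    ring
  have hWk : W (g - q) =ᵐ[μ] fun x => ((1 - a x * M x : ℝ) : ℂ) * W g x := by
    have : W (g - q) = W g - W q := map_sub _ _ _
    rw [this]
    filter_upwards [Lp.coeFn_sub (W g) (W q), hW q, hW g, hTq] with x h1 h2 h3 h4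
    rw [h1, Pi.sub_apply, h2, h3, h4]
    push_cast
    ring
  -- Tested against `h`, the claim is `⟨W(g - q), W h⟩ = ⟨q, h⟩`. Conditioning `|w|²` produces the
  -- weight `(1 - α E(|u|²)) v`, which is `α`.
  have hk : (g - q) + adjoint W (W (g - q)) = g := by
    refine ext_inner_right ℂ fun h => ?_
    rw [inner_add_left, inner_sub_left, adjoint_inner_left, hqinner h, sub_add_eq_add_sub,
      sub_eq_iff_eq_add, add_right_inj]
    set p : X → ℝ := fun x => D ^ 2 /
      (1 - D ^ 2 * ‖condE 𝒜 μ (fun y => u y * w y) x‖ ^ 2) with hp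
    have hpm : Measurable[𝒜] p := measurable_const.div (measurable_const.sub
      (((continuous_norm.measurable.comp
        (measurable_condE fun y => u y * w y)).pow_const 2).const_mul _))
    have e1 : (fun x => ⟪W (g - q) x, W h x⟫_ℂ) =ᵐ[μ] fun x =>
        (((1 - a x * M x) * p x : ℝ) : ℂ) * conj (Eg x) * condE 𝒜 μ (fun y => u y * h y) x
          * ((‖w x‖ ^ 2 : ℝ) : ℂ) := by
      filter_upwards [hWk, hW g, hW h, hT g, hT h, hK] with x h1 h2 h3 h4 h5 h6
      have hp0 : 0 ≤ p x := div_nonneg (by positivity) (by linarith)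
      have hs : ((√(p x) : ℝ) : ℂ) * ((√(p x) : ℝ) : ℂ) = p x := by
        rw [← Complex.ofReal_mul, Real.mul_self_sqrt hp0]
      have hww : w x * conj (w x) = ((‖w x‖ ^ 2 : ℝ) : ℂ) := by
        rw [RCLike.mul_conj]; simp
      rw [h1, h2, h3, h4, h5, RCLike.inner_apply]
      change (((√(p x) : ℝ) : ℂ) * _) * conj (_ * (((√(p x) : ℝ) : ℂ) * _)) = _
      rw [← hww, Complex.ofReal_mul _ (p x), ← hs]
      simp only [map_mul, Complex.conj_ofReal]
      ring
    have hc : Measurable[𝒜] fun x => (((1 - a x * M x) * p x : ℝ) : ℂ) * conj (Eg x) *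
        condE 𝒜 μ (fun y => u y * h y) x :=
      ((Complex.measurable_ofReal.comp ((measurable_const.sub (hαm.mul hMm)).mul hpm)).mul
        (Complex.continuous_conj.measurable.comp hEgm)).mul (measurable_condE _)
    rw [L2.inner_def, integral_congr_ae e1, integral_mul_condE (h𝒜 := h𝒜) hc
      (conditionable_norm_sq hw hw2) ((L2.integrable_inner _ _).congr e1)]
    refine integral_congr_ae ?_
    filter_upwards [hK] with x hx
    have h1 : (1 - a x * M x) * v 𝒜 μ w u D x = a x := one_sub_α_mul_mul_v (v_nonneg hx)
    have h2 : v 𝒜 μ w u D x = p x * (condSq 𝒜 μ w x).toReal := by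
      simp only [v, hp]
      ring
    have h3 : (((1 - a x * M x) * p x : ℝ) : ℂ) * ((condSq 𝒜 μ w x).toReal : ℂ) = a x := by
      rw [← Complex.ofReal_mul, mul_assoc, ← h2, h1]
    rw [condE_norm_sq, ← h3]
    ring
  refine ⟨memLp_two_of_lintegral ((measurable_weighted hvm _ _).mono h𝒜 le_rfl).aestronglyMeasurable
    (hWfin f), memLp_two_of_lintegral
    ((measurable_weighted hαm _ _).mono h𝒜 le_rfl).aestronglyMeasurable hαfin, ?_⟩
  rw [norm_R_mul_rankOne_mul_inverse_sq hWsq f hk, norm_sq_eq_lintegral (W f), ← hWl f, ← norm2_sq,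
    inner_sub_left, map_sub, inner_self_eq_norm_sq, hqinner g]
  congr 2
  have e2 : ∀ x, (a x : ℂ) * conj (Eg x) * Eg x = ((a x * ‖Eg x‖ ^ 2 : ℝ) : ℂ) := by
    intro x
    rw [mul_assoc, RCLike.conj_mul]
    simp
  simp_rw [← hEg, e2]
  rw [integral_complex_ofReal, norm2_sq]
  have e3 : ∫⁻ x, ‖weighted 𝒜 μ a u g x‖ₑ ^ 2 ∂μ = ∫⁻ x, ENNReal.ofReal (a x * ‖Eg x‖ ^ 2) ∂μ := by
    refine lintegral_congr_ae ?_
    filter_upwards [hK] with x hx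
    exact enorm_weighted_sq (α_nonneg (v_nonneg hx)) _
  rw [e3, ← integral_eq_lintegral_of_nonneg_ae]
  · exact RCLike.ofReal_re (K := ℂ) _
  · filter_upwards [hK] with x hx
    exact mul_nonneg (α_nonneg (v_nonneg hx)) (by positivity)
  · exact ((hαm.mul ((continuous_norm.measurable.comp hEgm).pow_const 2)).mono h𝒜
      le_rfl).aestronglyMeasurable

end Main
end SpectralRadiusAlgebra

/-! ### The theorem, by reduction to `E(|w|²) < ∞`. -/

open SpectralRadiusAlgebra in
theorem mainTheorem12 {X : Type*} {𝒜 ℱ : MeasurableSpace X} (h𝒜 : 𝒜 ≤ ℱ)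
    (μ : Measure[ℱ] X) [SigmaFinite μ] [SigmaFinite (μ.trim h𝒜)]
    (w u : X → ℂ) (hw : Conditionable 𝒜 μ w) (hu : Conditionable 𝒜 μ u)
    (hu_bdd : essSup (condSq 𝒜 μ u) μ < ⊤)
    (T : Lp ℂ 2 μ →L[ℂ] Lp ℂ 2 μ)
    (hT : ∀ h : Lp ℂ 2 μ, T h =ᵐ[μ] fun x => w x * condE 𝒜 μ (fun y => u y * h y) x)
    (f g : Lp ℂ 2 μ) :
    (∀ m : ℕ+, MemLp (weighted 𝒜 μ (v 𝒜 μ w u (d T m)) u f) 2 μ ∧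
      MemLp (weighted 𝒜 μ (α 𝒜 μ w u (d T m)) u g) 2 μ) ∧
    (InnerProductSpace.rankOne ℂ f g ∈ algebraB T ↔
      BddAbove (Set.range fun m : ℕ+ =>
        -(norm2 μ (weighted 𝒜 μ (α 𝒜 μ w u (d T m)) u g) ^ 2 * ‖f‖ ^ 2)
          + norm2 μ (weighted 𝒜 μ (v 𝒜 μ w u (d T m)) u f) ^ 2
            * (‖g‖ ^ 2 - norm2 μ (weighted 𝒜 μ (α 𝒜 μ w u (d T m)) u g) ^ 2))) := by
  have hu2 : ∀ᵐ x ∂μ, condSq 𝒜 μ u x < ⊤ :=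
    (ENNReal.ae_le_essSup _).mono fun x hx => hx.trans_lt hu_bdd
  have hzero := eq_zero_of_condSq_eq_top (h𝒜 := h𝒜) hw.1 hu.1 hu2 hT
  set B : Set X := {x | condSq 𝒜 μ w x < ⊤} with hB_def
  have hB : MeasurableSet[𝒜] B := measurable_condSq w measurableSet_Iio
  -- Off `B` almost everywhere `u = 0`, so cutting `w` down to `B` changes neither `T` nor `uw`, and
  -- makes `E(|w'|²)` finite almost everywhere.
  set w' : X → ℂ := B.indicator w with hw'_def
  have hw' : AEStronglyMeasurable w' μ := hw.1.indicator (h𝒜 _ hB)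
  have hsq : condSq 𝒜 μ w' =ᵐ[μ] B.indicator (condSq 𝒜 μ w) := by
    have h1 := condLExp_mul (h𝒜 := h𝒜)
      ((measurable_const (a := (1 : ENNReal))).indicator hB) (hw.1.enorm.pow_const 2)
    have h2 : (fun x => B.indicator (fun _ => (1 : ENNReal)) x * ‖w x‖ₑ ^ 2)
        = fun x => ‖w' x‖ₑ ^ 2 := by
      ext x
      by_cases hx : x ∈ B <;> simp [hw'_def, hx]
    rw [h2] at h1
    filter_upwards [h1] with x hx
    refine hx.trans ?_
    by_cases hxB : x ∈ B <;> simp [hxB, condSq]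
  have hw2 : ∀ᵐ x ∂μ, condSq 𝒜 μ w' x < ⊤ := by
    filter_upwards [hsq] with x hx
    rw [hx]
    by_cases hxB : x ∈ B
    · rw [Set.indicator_of_mem hxB]; exact hxB
    · simp [hxB]
  have huw : (fun y => u y * w y) =ᵐ[μ] fun y => u y * w' y := by
    filter_upwards [hzero] with x hx
    by_cases hxB : x ∈ B
    · simp [hw'_def, hxB]
    · simp [hx (by simpa [hB_def] using hxB)]
  have hT' : ∀ h : Lp ℂ 2 μ, T h =ᵐ[μ] fun x => w' x * condE 𝒜 μ (fun y => u y * h y) x := by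
    intro h
    have hc : Measurable[𝒜] (Bᶜ.indicator fun _ => (1 : ℂ)) := measurable_const.indicator hB.compl
    have e1 := condE_mul (h𝒜 := h𝒜) hc (conditionable_mul hu.1 (Lp.aestronglyMeasurable h) hu2
      (condSq_lt_top_of_memLp (Lp.memLp h)))
    have e2 : (fun x => Bᶜ.indicator (fun _ => (1 : ℂ)) x * (u x * h x)) =ᵐ[μ] fun _ => 0 := by
      filter_upwards [hzero] with x hx
      by_cases hxB : x ∈ B
      · simp [hxB]
      · simp [hx (by simpa [hB_def] using hxB)]
    filter_upwards [hT h, e1, condE_congr (𝒜 := 𝒜) e2] with x h1 h2 h3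
    rw [h1]
    by_cases hxB : x ∈ B
    · simp [hw'_def, hxB]
    · rw [h3, condE_zero, Set.indicator_of_mem (by exact hxB), one_mul] at h2
      simp [← h2]
  have hv : ∀ D, v 𝒜 μ w' u D =ᵐ[μ] v 𝒜 μ w u D := by
    intro D
    filter_upwards [hsq, condE_congr (𝒜 := 𝒜) huw] with x h1 h2
    -- Off `B` both sides are `0`, as `toReal` sends `∞` to `0`; this is the stated convention for
    -- `v_m`.
    have h3 : (B.indicator (condSq 𝒜 μ w) x).toReal = (condSq 𝒜 μ w x).toReal := by
      by_cases hxB : x ∈ B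
      · simp [hxB]
      · have : condSq 𝒜 μ w x = ⊤ := by simpa [hB_def] using hxB
        simp [hxB, this]
    simp only [v, h1, h2, h3]
  have hvw : ∀ D, weighted 𝒜 μ (v 𝒜 μ w' u D) u f =ᵐ[μ] weighted 𝒜 μ (v 𝒜 μ w u D) u f :=
    fun D => (hv D).mono fun x hx => by simp only [weighted, hx]
  have hαw : ∀ D, weighted 𝒜 μ (α 𝒜 μ w' u D) u g =ᵐ[μ] weighted 𝒜 μ (α 𝒜 μ w u D) u g :=
    fun D => (hv D).mono fun x hx => by simp only [weighted, α, hx]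
  have key := fun m => norm_R_mul_rankOne_mul_inverse_sq_eq (h𝒜 := h𝒜) hw' hu.1 hw2 hu2 hT' m f g
  refine ⟨fun m => ⟨(memLp_congr_ae (hvw _)).1 (key m).1, (memLp_congr_ae (hαw _)).1 (key m).2.1⟩, ?_⟩
  -- The squared norm differs from the expression of the theorem by a constant independent of `m`,
  -- so the two suprema are finite together.
  have hnorm : ∀ m : ℕ+, ‖R T m * InnerProductSpace.rankOne ℂ f g * Ring.inverse (R T m)‖ ^ 2
      = ‖f‖ ^ 2 * ‖g‖ ^ 2 +
        (-(norm2 μ (weighted 𝒜 μ (α 𝒜 μ w u (d T m)) u g) ^ 2 * ‖f‖ ^ 2)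
          + norm2 μ (weighted 𝒜 μ (v 𝒜 μ w u (d T m)) u f) ^ 2
            * (‖g‖ ^ 2 - norm2 μ (weighted 𝒜 μ (α 𝒜 μ w u (d T m)) u g) ^ 2)) := by
    intro m
    rw [(key m).2.2]
    simp only [norm2, eLpNorm_congr_ae (hvw (d T m)), eLpNorm_congr_ae (hαw (d T m))]
    ring
  constructor
  · rintro ⟨C, hC⟩
    refine ⟨C ^ 2 - ‖f‖ ^ 2 * ‖g‖ ^ 2, ?_⟩
    rintro _ ⟨m, rfl⟩
    have h1 := hC ⟨m, rfl⟩
    have h2 := pow_le_pow_left₀ (norm_nonneg _) h1 2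
    have h3 := hnorm m
    simp only at h2 ⊢
    linarith
  · rintro ⟨C, hC⟩
    refine ⟨√(‖f‖ ^ 2 * ‖g‖ ^ 2 + C), ?_⟩
    rintro _ ⟨m, rfl⟩
    refine Real.le_sqrt_of_sq_le ?_
    have h1 := hC ⟨m, rfl⟩
    have h3 := hnorm m
    simp only at h1 ⊢
    linarith
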